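/- Conventions. Rings are associative with $1$. For a ring $T$ and a right $T$-module $N$, $\mathrm{Add}(N)$ is the full subcategory of right $T$-modules isomorphic to direct summands of direct sums $N^{(\Lambda)}$, $\Lambda$ an arbitrary set. For right $T$-modules $X, A, B$, let $\mathcal{I}_X(A,B)$ be the group of homomorphisms $A\to B$ that factor through $X^n$ for some $n\in\mathbb{N}$, and $\mathcal{J}_X(A,B)$ the group of those that factor through $X^{(\Lambda)}$ for some set $\Lambda$. For a full subcategory $\mathcal C$ of right $T$-modules, $\mathcal C/\mathcal{J}_X$ is the category with the same objects as $\mathcal C$ and with morphism sets $\mathrm{Hom}_T(A,B)/\mathcal{J}_X(A,B)$. The trace of a right $T$-module $P$ is the two-sided ideal $\mathrm{Tr}_T(P)=\sum_{f\in\mathrm{Hom}_T(P,T)}f(P)$ of $T$. Theorem. Let $M$ be a finitely generated right module over a ring $R$, and let $S=\mathrm{End}_R(M)$. Let $X$ be an object of $\mathrm{Add}(M)$, and let $I=\mathrm{Tr}_S(P)$, where $P=\mathrm{Hom}_R(M,X)$ is regarded as a right $S$-module by composition. Then: (i) $I=\mathcal{I}_X(M,M)=\mathcal{J}_X(M,M)$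 and, for any $B\in\mathrm{Add}(M)$, $\mathcal{I}_X(M,B)=\mathcal{J}_X(M,B)=\mathrm{Hom}_R(M,B)\,I$, the group of finite sums of homomorphisms $f\circ s$ with $f\in\mathrm{Hom}_R(M,B)$ and $s\in I$. (ii) The functor $F=\mathrm{Hom}_R(M,-)\otimes_S S/I$ induces an equivalence between the categories $\mathrm{Add}(M)/\mathcal{J}_X$ and $\mathrm{Add}(S/I)$, where $S/I$ is regarded as a right module over itself. (iii) Let $\mathrm{Add}_{\aleph_0}(M)$ be the full subcategory of $\mathrm{Add}(M)$ whose objects are the countably generated modules in $\mathrm{Add}(M)$. If $X$ is an object of $\mathrm{Add}_{\aleph_0}(M)$, then $F$ restricts to an equivalence between $\mathrm{Add}_{\aleph_0}(M)/\mathcal{J}_X$ and the category of countably generated projective right modules over $S/I$. -/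

import Mathlib

universe u v w

set_option linter.unusedSectionVars false

namespace TraceQuotient

open CategoryTheory MulOpposite
open scoped TensorProduct

/-! Right modules over a ring `R` are modules over `Rᵐᵒᵖ`. -/

/-! ### `Add(M)` and countably generated modules -/

/-- `Add(M)`: the modules `A` that are isomorphic to a direct summand of a direct sum `M^(Λ)`. -/
def addClosure {T : Type u} [Ring T] (M : ModuleCat.{v} T) : ObjectProperty (ModuleCat.{v} T) :=
  fun A => ∃ (Λ : Type v) (C : ModuleCat.{v} T), Nonempty ((A × C) ≃ₗ[T] (Λ →₀ M))

/-- A module is countably generated if it is spanned by a countable set. -/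
def IsCountablyGenerated {T : Type u} [Ring T] (A : ModuleCat.{v} T) : Prop :=
  ∃ s : Set A, s.Countable ∧ Submodule.span T s = ⊤

/-- `Add_ℵ₀(M)`: the countably generated modules in `Add(M)`. -/
def countableAddClosure {T : Type u} [Ring T] (M : ModuleCat.{v} T) :
    ObjectProperty (ModuleCat.{v} T) :=
  fun A => addClosure M A ∧ IsCountablyGenerated A

/-- The countably generated projective modules. -/
def countableProjective (T : Type u) [Ring T] : ObjectProperty (ModuleCat.{v} T) :=
  fun A => Module.Projective T A ∧ IsCountablyGenerated A

/-! ### The ideals `𝓘_X` and `𝓙_X` -/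

section Ideals

variable {T : Type u} [Ring T]

/-- The morphism `f` factors through the direct sum `X^(Λ)`. -/
def FactorsThroughCopower (X : ModuleCat.{v} T) (Λ : Type w) {A B : ModuleCat.{v} T}
    (f : A ⟶ B) : Prop :=
  ∃ (g : A →ₗ[T] (Λ →₀ X)) (h : (Λ →₀ X) →ₗ[T] B), f.hom = h ∘ₗ g

variable {X A B C : ModuleCat.{v} T}

theorem FactorsThroughCopower.zero (Λ : Type w) :
    FactorsThroughCopower X Λ (0 : A ⟶ B) :=
  ⟨0, 0, by simp⟩

theorem FactorsThroughCopower.neg {Λ : Type w} {f : A ⟶ B}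
    (hf : FactorsThroughCopower X Λ f) : FactorsThroughCopower X Λ (-f) := by
  obtain ⟨g, h, e⟩ := hf
  exact ⟨g, -h, by rw [ModuleCat.hom_neg, e, LinearMap.neg_comp]⟩

theorem FactorsThroughCopower.add {Λ Λ' Λ'' : Type*} (e : Λ ⊕ Λ' ≃ Λ'') {f f' : A ⟶ B}
    (hf : FactorsThroughCopower X Λ f) (hf' : FactorsThroughCopower X Λ' f') :
    FactorsThroughCopower X Λ'' (f + f') := by
  obtain ⟨g, h, eq⟩ := hf
  obtain ⟨g', h', eq'⟩ := hf'
  let E : (Λ'' →₀ X) ≃ₗ[T] (Λ →₀ X) × (Λ' →₀ X) :=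
    (Finsupp.domLCongr e.symm).trans (Finsupp.sumFinsuppLEquivProdFinsupp T)
  refine ⟨E.symm.toLinearMap ∘ₗ g.prod g', h.coprod h' ∘ₗ E.toLinearMap, ?_⟩
  ext a
  simp [eq, eq']

theorem FactorsThroughCopower.comp_left {Λ : Type w} {f : A ⟶ B} (g : B ⟶ C)
    (hf : FactorsThroughCopower X Λ f) : FactorsThroughCopower X Λ (f ≫ g) := by
  obtain ⟨p, q, e⟩ := hf
  exact ⟨p, g.hom ∘ₗ q, by rw [ModuleCat.hom_comp, e, LinearMap.comp_assoc]⟩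

theorem FactorsThroughCopower.comp_right {Λ : Type w} (f : A ⟶ B) {g : B ⟶ C}
    (hg : FactorsThroughCopower X Λ g) : FactorsThroughCopower X Λ (f ≫ g) := by
  obtain ⟨p, q, e⟩ := hg
  exact ⟨p ∘ₗ f.hom, q, by rw [ModuleCat.hom_comp, e, LinearMap.comp_assoc]⟩

variable (X A B)

/-- `𝓘_X(A, B)`: the morphisms `A ⟶ B` that factor through `X^n` for some natural number `n`. -/
def finiteIdeal : AddSubgroup (A ⟶ B) where
  carrier := {f | ∃ n : ℕ, FactorsThroughCopower X (Fin n) f}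
  zero_mem' := ⟨0, .zero _⟩
  add_mem' := by
    rintro f g ⟨n, hf⟩ ⟨m, hg⟩
    exact ⟨n + m, hf.add finSumFinEquiv hg⟩
  neg_mem' := by
    rintro f ⟨n, hf⟩
    exact ⟨n, hf.neg⟩

/-- `𝓙_X(A, B)`: the morphisms `A ⟶ B` that factor through `X^(Λ)` for some set `Λ`. -/
def infiniteIdeal : AddSubgroup (A ⟶ B) where
  carrier := {f | ∃ Λ : Type v, FactorsThroughCopower X Λ f}
  zero_mem' := ⟨PEmpty, .zero _⟩
  add_mem' := by
    rintro f g ⟨Λ, hf⟩ ⟨Λ', hg⟩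
    exact ⟨Λ ⊕ Λ', hf.add (Equiv.refl _) hg⟩
  neg_mem' := by
    rintro f ⟨Λ, hf⟩
    exact ⟨Λ, hf.neg⟩

/-- Congruence modulo `𝓙_X` on a full subcategory of modules. -/
def idealRel (P : ObjectProperty (ModuleCat.{v} T)) (X : ModuleCat.{v} T) :
    HomRel P.FullSubcategory :=
  fun A B f g => f.hom - g.hom ∈ infiniteIdeal X A.obj B.obj

instance idealRel_congruence (P : ObjectProperty (ModuleCat.{v} T)) (X : ModuleCat.{v} T) :
    Congruence (idealRel P X) where
  comp_left f g g' h := by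
    obtain ⟨Λ, h⟩ := h
    refine ⟨Λ, ?_⟩
    simpa [Preadditive.comp_sub] using h.comp_right f.hom
  comp_right g h := by
    obtain ⟨Λ, h⟩ := h
    refine ⟨Λ, ?_⟩
    simpa [Preadditive.sub_comp] using h.comp_left g.hom
  equivalence :=
    { refl := fun f => by
        change f.hom - f.hom ∈ infiniteIdeal X _ _
        rw [sub_self]
        exact AddSubgroup.zero_mem _
      symm := fun {f g} h => by
        change g.hom - f.hom ∈ infiniteIdeal X _ _
        rw [← neg_sub]
        exact AddSubgroup.neg_mem _ h
      trans := fun {f g k} h h' => by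
        change f.hom - k.hom ∈ infiniteIdeal X _ _
        rw [← sub_add_sub_cancel f.hom g.hom k.hom]
        exact AddSubgroup.add_mem _ h h' }

/-- The quotient category of a full subcategory by `𝓙_X`: it has the same objects, and the
morphisms from `A` to `B` are the elements of `Hom(A, B) / 𝓙_X(A, B)`. -/
abbrev IdealQuotient (P : ObjectProperty (ModuleCat.{v} T)) (X : ModuleCat.{v} T) :=
  CategoryTheory.Quotient (idealRel P X)

end Ideals

/-! ### The trace of a right module -/

section Trace

variable (S : Type u) [Ring S] (P : Type v) [AddCommGroup P] [Module Sᵐᵒᵖ P]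

/-- The trace of a right `S`-module `P` as a right ideal: the sum of the images of all
homomorphisms of right modules `P → S`. -/
def rightTrace : Submodule Sᵐᵒᵖ S := ⨆ f : P →ₗ[Sᵐᵒᵖ] S, LinearMap.range f

theorem mul_mem_rightTrace (s : S) {x : S} (hx : x ∈ rightTrace S P) :
    s * x ∈ rightTrace S P := by
  let l : S →ₗ[Sᵐᵒᵖ] S :=
    { toFun := fun y => s * y
      map_add' := mul_add s
      map_smul' := fun r y => by simp [mul_assoc] }
  have h : rightTrace S P ≤ (rightTrace S P).comap l := by
    refine iSup_le fun f => ?_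
    rintro _ ⟨p, rfl⟩
    exact le_iSup (fun g : P →ₗ[Sᵐᵒᵖ] S => LinearMap.range g) (l ∘ₗ f) ⟨p, rfl⟩
  exact h hx

/-- The trace of a right `S`-module `P`, as a (two-sided) ideal of `S`. -/
def traceIdeal : Ideal S where
  carrier := rightTrace S P
  zero_mem' := zero_mem _
  add_mem' := add_mem
  smul_mem' s _ hx := mul_mem_rightTrace S P s hx

instance traceIdeal_isTwoSided : (traceIdeal S P).IsTwoSided where
  mul_mem_of_left b ha := (rightTrace S P).smul_mem (op b) ha

end Trace

/-! ### The tensor product `P ⊗_S N` of a right module and a bimodule -/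

section Tensor

variable (S : Type*) (U : Type*) [Ring S] [Ring U]
  (N : Type*) [AddCommGroup N] [Module S N] [Module Uᵐᵒᵖ N] [SMulCommClass S Uᵐᵒᵖ N]
  (P : Type*) [AddCommGroup P] [Module Sᵐᵒᵖ P]

/-- The relations `(p s) ⊗ n = p ⊗ (s n)`. The right `U`-action comes from `N`, which therefore
is written as the first factor of the tensor product over `ℤ`. -/
def balancedRelations : Submodule Uᵐᵒᵖ (N ⊗[ℤ] P) :=
  Submodule.span Uᵐᵒᵖ {t | ∃ (n : N) (s : S) (p : P), t = n ⊗ₜ[ℤ] (op s • p) - (s • n) ⊗ₜ[ℤ] p}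

/-- The right `U`-module `P ⊗_S N`, for a right `S`-module `P` and an `S`-`U`-bimodule `N`;
`p ⊗ n` is the class of `n ⊗ₜ p`. -/
abbrev BalancedTensor : Type _ := (N ⊗[ℤ] P) ⧸ balancedRelations S U N P

variable {P} {P' : Type*} [AddCommGroup P'] [Module Sᵐᵒᵖ P']

/-- `n ⊗ₜ p ↦ n ⊗ₜ f p`. -/
def preTensorMap (f : P →ₗ[Sᵐᵒᵖ] P') : N ⊗[ℤ] P →ₗ[Uᵐᵒᵖ] N ⊗[ℤ] P' :=
  TensorProduct.AlgebraTensorModule.map LinearMap.id f.toAddMonoidHom.toIntLinearMap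

@[simp]
theorem preTensorMap_tmul (f : P →ₗ[Sᵐᵒᵖ] P') (n : N) (p : P) :
    preTensorMap S U N f (n ⊗ₜ p) = n ⊗ₜ f p := rfl

/-- The homomorphism `f ⊗_S N : P ⊗_S N → P' ⊗_S N`. -/
def balancedTensorMap (f : P →ₗ[Sᵐᵒᵖ] P') :
    BalancedTensor S U N P →ₗ[Uᵐᵒᵖ] BalancedTensor S U N P' :=
  Submodule.mapQ _ _ (preTensorMap S U N f) <| by
    refine Submodule.span_le.2 ?_
    rintro _ ⟨n, s, p, rfl⟩
    refine Submodule.subset_span ⟨n, s, f p, ?_⟩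
    simp

@[simp]
theorem balancedTensorMap_mk (f : P →ₗ[Sᵐᵒᵖ] P') (x : N ⊗[ℤ] P) :
    balancedTensorMap S U N f (Submodule.Quotient.mk x) =
      Submodule.Quotient.mk (preTensorMap S U N f x) := rfl

end Tensor

/-- The functor `- ⊗_S N` from right `S`-modules to right `U`-modules. -/
def tensorFunctor (S U N : Type v) [Ring S] [Ring U] [AddCommGroup N] [Module S N]
    [Module Uᵐᵒᵖ N] [SMulCommClass S Uᵐᵒᵖ N] : ModuleCat.{v} Sᵐᵒᵖ ⥤ ModuleCat.{v} Uᵐᵒᵖ where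
  obj P := ModuleCat.of Uᵐᵒᵖ (BalancedTensor S U N P)
  map f := ModuleCat.ofHom (balancedTensorMap S U N f.hom)
  map_id P := by
    refine ModuleCat.hom_ext (LinearMap.ext fun x => ?_)
    obtain ⟨x, rfl⟩ := Submodule.Quotient.mk_surjective _ x
    induction x using TensorProduct.induction_on with
    | zero => simp
    | tmul n p => rfl
    | add x y hx hy => rw [Submodule.Quotient.mk_add, map_add, map_add, hx, hy]
  map_comp f g := by
    refine ModuleCat.hom_ext (LinearMap.ext fun x => ?_)
    obtain ⟨x, rfl⟩ := Submodule.Quotient.mk_surjective _ x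
    induction x using TensorProduct.induction_on with
    | zero => simp
    | tmul n p => rfl
    | add x y hx hy => rw [Submodule.Quotient.mk_add, map_add, map_add, hx, hy]

section Main

variable {R : Type u} [Ring R]

instance quotient_smulCommClass {S : Type v} [Ring S] (I : Ideal S) [I.IsTwoSided] :
    SMulCommClass S (S ⧸ I)ᵐᵒᵖ (S ⧸ I) where
  smul_comm s t x := by
    obtain ⟨x, rfl⟩ := Ideal.Quotient.mk_surjective x
    obtain ⟨t, rfl⟩ := op_surjective t
    obtain ⟨t, rfl⟩ := Ideal.Quotient.mk_surjective t
    change Ideal.Quotient.mk I (s * (x * t)) = Ideal.Quotient.mk I ((s * x) * t)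
    rw [mul_assoc]

/-- The trace ideal, in `S = End_R(M)`, of the right `S`-module `Hom_R(M, X)`.
The multiplication of `End M` is `s * t = s ∘ t`, and `s` acts on `Hom_R(M, X)` from the right
by `f ↦ f ∘ s`. -/
abbrev homTrace (M X : ModuleCat.{v} Rᵐᵒᵖ) : Ideal (End M) :=
  traceIdeal (End M) ((preadditiveCoyonedaObj M).obj X)

/-- `Hom_R(M, B) I`: the subgroup of finite sums of morphisms `f ∘ s` with `f : M ⟶ B` and
`s ∈ I`. -/
def homMulIdeal (M B : ModuleCat.{v} Rᵐᵒᵖ) (I : Ideal (End M)) : AddSubgroup (M ⟶ B) :=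
  AddSubgroup.closure {h | ∃ (f : M ⟶ B) (s : M ⟶ M), s ∈ I ∧ h = s ≫ f}

/-- The functor `Hom_R(M, -) ⊗_S S/I` from right `R`-modules to right `S/I`-modules, where
`S = End_R(M)`. -/
def homTensor (M : ModuleCat.{v} Rᵐᵒᵖ) (I : Ideal (End M)) [I.IsTwoSided] :
    ModuleCat.{v} Rᵐᵒᵖ ⥤ ModuleCat.{v} (End M ⧸ I)ᵐᵒᵖ :=
  preadditiveCoyonedaObj M ⋙ tensorFunctor (End M) (End M ⧸ I) (End M ⧸ I)

/-- The functor `F` on right `R`-modules induces an equivalence from the quotient of the full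
subcategory `P` by `𝓙_X` to the full subcategory `Q`: it maps `P` into `Q`, it identifies morphisms
of `P` that are congruent modulo `𝓙_X`, and the resulting functor is an equivalence. -/
def InducesEquivalence {T : Type u} [Ring T] {D : Type*} [Category D] (F : ModuleCat.{v} T ⥤ D)
    (P : ObjectProperty (ModuleCat.{v} T)) (X : ModuleCat.{v} T) (Q : ObjectProperty D) : Prop :=
  ∃ (hobj : ∀ A : P.FullSubcategory, Q ((P.ι ⋙ F).obj A))
    (hmap : ∀ (A B : P.FullSubcategory) (f g : A ⟶ B), idealRel P X f g →
      (Q.lift (P.ι ⋙ F) hobj).map f = (Q.lift (P.ι ⋙ F) hobj).map g),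
    (CategoryTheory.Quotient.lift (idealRel P X) (Q.lift (P.ι ⋙ F) hobj) hmap :
      IdealQuotient P X ⥤ Q.FullSubcategory).IsEquivalence

end Main

end TraceQuotient

open CategoryTheory TraceQuotient

/-! Composites are written in the order of `≫`. A map from the finitely generated `M` into a direct
sum meets only finitely many summands. As `X` is a retract of some `M^(Λ)`, every `f : M ⟶ X` is a
finite sum of maps `f ≫ a k ≫ b k` passing through `M` (`exists_sum_comp_eq`). This dual basis
identity yields (i).

Tensoring with `S/I` turns `P` into `P / P I` (`balancedMk_eq_zero_iff`), so by (i) `F(B)` is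
`Hom(M, B)` modulo `𝓙_X(M, B)`. Fullness and faithfulness reduce to the source `M^(Λ)`, where they
are checked on each copy of `M` (`homTensor_full`, `homTensor_map_eq_zero_iff`).

The hard point is density (`exists_iso_of_isRetractOfCopower`). A summand of `(S/I)^(Λ)` is given by
an idempotent of `F(L)`, `L = M^(Λ)`. It lifts to some `ε : L ⟶ L` for which `ε - ε²` factors
through a copower of `X`, but `ε` need not be idempotent. On `N = L^(ℕ)` let `e` be `ε` in each
coordinate, and put `s = 1 - e + e up` and `p = 1 - e + e down` with the two shifts. Modulo `𝓙_X`,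
`s p = 1`, while `p s` is `1` minus `ε` on coordinate zero. The error in `s p = 1` factors through a
copower `Y` of `X`. Adding `Y` absorbs it: `N` becomes a true summand of `N ⊕ Y`, and `F` sends the
complement to the image of the idempotent (`exists_splitting_of_map_idempotent`). The construction
preserves countability of index sets, whence (iii). -/

namespace TraceQuotient

open CategoryTheory MulOpposite
open scoped TensorProduct

/-! ### Retracts of direct sums and countable generation -/

section Retracts

variable {T : Type u} [Ring T]

/-- `A` is a retract of the direct sum `M^(Λ)`. -/
def IsRetractOfCopower (M : ModuleCat.{v} T) (Λ : Type w) (A : ModuleCat.{v} T) : Prop :=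
  ∃ (i : A →ₗ[T] (Λ →₀ M)) (r : (Λ →₀ M) →ₗ[T] A), r ∘ₗ i = LinearMap.id

/-- The complement of a retract is the kernel of the retraction. Retracts need no chosen complement
and are preserved by functors. -/
theorem addClosure_iff_exists_isRetractOfCopower {M A : ModuleCat.{v} T} :
    addClosure M A ↔ ∃ Λ : Type v, IsRetractOfCopower M Λ A := by
  constructor
  · rintro ⟨Λ, C, ⟨e⟩⟩
    exact ⟨Λ, e.toLinearMap ∘ₗ LinearMap.inl T A C,
      LinearMap.fst T A C ∘ₗ e.symm.toLinearMap, by ext; simp⟩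
  · rintro ⟨Λ, i, r, h⟩
    have h' : ∀ a, r (i a) = a := fun a => LinearMap.congr_fun h a
    refine ⟨Λ, ModuleCat.of T (LinearMap.ker r), ⟨LinearEquiv.symm (LinearEquiv.ofLinearMap
      (LinearMap.prod r (LinearMap.codRestrict (LinearMap.ker r) (LinearMap.id - i ∘ₗ r) ?_))
      (i.coprod (LinearMap.ker r).subtype) ?_ ?_)⟩⟩
    · intro x
      simp [h']
    · refine LinearMap.ext fun x => ?_
      obtain ⟨a, ⟨k, hk⟩⟩ := x
      have hk' : r k = 0 := hk
      refine Prod.ext ?_ (Subtype.ext ?_) <;> simp [h', hk']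
    · refine LinearMap.ext fun x => ?_
      simp

theorem IsRetractOfCopower.of_retract {M A B : ModuleCat.{v} T} {Λ : Type w}
    (hB : IsRetractOfCopower M Λ B) (i : A →ₗ[T] B) (r : B →ₗ[T] A) (h : r ∘ₗ i = LinearMap.id) :
    IsRetractOfCopower M Λ A := by
  obtain ⟨j, s, hs⟩ := hB
  refine ⟨j ∘ₗ i, r ∘ₗ s, ?_⟩
  rw [LinearMap.comp_assoc, ← LinearMap.comp_assoc i, hs, LinearMap.id_comp, h]

theorem IsRetractOfCopower.of_linearEquiv {M A : ModuleCat.{v} T} {Λ : Type w}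
    (e : A ≃ₗ[T] (Λ →₀ M)) : IsRetractOfCopower M Λ A :=
  ⟨e, e.symm, by ext; simp⟩

theorem IsRetractOfCopower.copower {M A : ModuleCat.{v} T} {Λ : Type w}
    (hA : IsRetractOfCopower M Λ A) (K : Type v) :
    IsRetractOfCopower M (K × Λ) (ModuleCat.of T (K →₀ A)) := by
  obtain ⟨i, r, h⟩ := hA
  refine ⟨(Finsupp.curryLinearEquiv T).symm.toLinearMap ∘ₗ Finsupp.mapRange.linearMap i,
    Finsupp.mapRange.linearMap r ∘ₗ (Finsupp.curryLinearEquiv T).toLinearMap, ?_⟩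
  refine LinearMap.ext fun x => Finsupp.ext fun k => ?_
  simpa using LinearMap.congr_fun h (x k)

theorem IsRetractOfCopower.prod {M A B : ModuleCat.{v} T} {Λ Λ' : Type w}
    (hA : IsRetractOfCopower M Λ A) (hB : IsRetractOfCopower M Λ' B) :
    IsRetractOfCopower M (Λ ⊕ Λ') (ModuleCat.of T (A × B)) := by
  obtain ⟨i, r, h⟩ := hA
  obtain ⟨i', r', h'⟩ := hB
  refine ⟨(Finsupp.sumFinsuppLEquivProdFinsupp T).symm.toLinearMap ∘ₗ LinearMap.prodMap i i',
    LinearMap.prodMap r r' ∘ₗ (Finsupp.sumFinsuppLEquivProdFinsupp T).toLinearMap, ?_⟩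
  refine LinearMap.ext fun x => Prod.ext ?_ ?_
  · simpa using LinearMap.congr_fun h x.1
  · simpa using LinearMap.congr_fun h' x.2

/-- The images of countably many generators have finite supports, and the union of these is a
countable set of indices that contains the support of everything in the image of the section. -/
theorem IsRetractOfCopower.exists_countable {M A : ModuleCat.{v} T} {Λ : Type w}
    (hA : IsRetractOfCopower M Λ A) (hc : IsCountablyGenerated A) :
    ∃ s : Set Λ, s.Countable ∧ IsRetractOfCopower M s A := by
  obtain ⟨i, r, h⟩ := hA
  obtain ⟨t, ht, hs⟩ := hc
  let S : Set Λ := ⋃ a ∈ t, ((i a).support : Set Λ)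
  refine ⟨S, ht.biUnion fun a _ => (i a).support.countable_toSet,
    Finsupp.lsubtypeDomain S ∘ₗ i, r ∘ₗ Finsupp.lmapDomain M T Subtype.val, ?_⟩
  refine LinearMap.ext_on hs fun a ha => ?_
  have hsub : ((i a).support : Set Λ) ⊆ S := Set.subset_biUnion_of_mem (u := fun a =>
    ((i a).support : Set Λ)) ha
  have : Finsupp.mapDomain Subtype.val (Finsupp.subtypeDomain (fun x => x ∈ S) (i a)) = i a := by
    refine Finsupp.ext fun x => ?_
    by_cases hx : x ∈ S
    · exact (Finsupp.mapDomain_apply Subtype.val_injective _ (⟨x, hx⟩ : S)).trans rfl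
    · rw [Finsupp.mapDomain_of_notMem_range _ _ (by simpa using hx)]
      by_contra hne
      exact hx (hsub (Finsupp.mem_support_iff.2 (Ne.symm hne)))
  change r (Finsupp.mapDomain Subtype.val (Finsupp.subtypeDomain (fun x => x ∈ S) (i a))) = a
  rw [this]
  exact LinearMap.congr_fun h a

theorem IsRetractOfCopower.isCountablyGenerated {M A : ModuleCat.{v} T} {Λ : Type w}
    [Countable Λ] (hA : IsRetractOfCopower M Λ A) (hM : IsCountablyGenerated M) :
    IsCountablyGenerated A := by
  obtain ⟨i, r, h⟩ := hA
  obtain ⟨t, ht, hs⟩ := hM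
  refine ⟨⋃ l : Λ, (r ∘ₗ Finsupp.lsingle l) '' t,
    Set.countable_iUnion fun l => ht.image _, ?_⟩
  rw [Submodule.span_iUnion]
  simp_rw [Submodule.span_image, hs, Submodule.map_top, LinearMap.range_comp]
  rw [← Submodule.map_iSup, Finsupp.iSup_lsingle_range, Submodule.map_top]
  exact LinearMap.range_eq_top.2 fun a => ⟨i a, LinearMap.congr_fun h a⟩

theorem isCountablyGenerated_of_finite (M : ModuleCat.{v} T) [Module.Finite T M] :
    IsCountablyGenerated M := by
  obtain ⟨s, hs⟩ := (Module.Finite.fg_top : (⊤ : Submodule T M).FG)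
  exact ⟨s, s.countable_toSet, hs⟩

theorem countableAddClosure_iff_exists_isRetractOfCopower {M A : ModuleCat.{v} T}
    (hM : IsCountablyGenerated M) :
    countableAddClosure M A ↔ ∃ Λ : Type v, Countable Λ ∧ IsRetractOfCopower M Λ A := by
  constructor
  · rintro ⟨h, hc⟩
    obtain ⟨Λ, h⟩ := addClosure_iff_exists_isRetractOfCopower.1 h
    obtain ⟨s, hs, h⟩ := h.exists_countable hc
    exact ⟨s, hs.to_subtype, h⟩
  · rintro ⟨Λ, hΛ, h⟩
    exact ⟨addClosure_iff_exists_isRetractOfCopower.2 ⟨Λ, h⟩, h.isCountablyGenerated hM⟩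

end Retracts

/-! ### Factorizations through finite and infinite copowers -/

section Ideals

variable {T : Type u} [Ring T] {M X A B : ModuleCat.{v} T}

theorem finiteIdeal_comp_left {f : A ⟶ B} {C : ModuleCat.{v} T} (g : B ⟶ C)
    (hf : f ∈ finiteIdeal X A B) : f ≫ g ∈ finiteIdeal X A C := by
  obtain ⟨n, hf⟩ := hf
  exact ⟨n, hf.comp_left g⟩

theorem infiniteIdeal_comp_right {C : ModuleCat.{v} T} (f : A ⟶ B) {g : B ⟶ C}
    (hg : g ∈ infiniteIdeal X B C) : f ≫ g ∈ infiniteIdeal X A C := by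
  obtain ⟨n, hg⟩ := hg
  exact ⟨n, hg.comp_right f⟩

theorem FactorsThroughCopower.congr {Λ : Type*} {Λ' : Type*} (e : Λ ≃ Λ') {f : A ⟶ B}
    (hf : FactorsThroughCopower X Λ f) : FactorsThroughCopower X Λ' f := by
  obtain ⟨g, h, eq⟩ := hf
  refine ⟨(Finsupp.domLCongr e).toLinearMap ∘ₗ g, h ∘ₗ (Finsupp.domLCongr e).symm.toLinearMap, ?_⟩
  rw [LinearMap.comp_assoc, ← LinearMap.comp_assoc g, LinearEquiv.symm_comp,
    LinearMap.id_comp, eq]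

theorem finiteIdeal_le_infiniteIdeal : finiteIdeal X A B ≤ infiniteIdeal X A B := by
  rintro f ⟨n, hf⟩
  exact ⟨ULift (Fin n), hf.congr Equiv.ulift.symm⟩

theorem comp_mem_finiteIdeal (f : A ⟶ X) (g : X ⟶ B) : f ≫ g ∈ finiteIdeal X A B :=
  ⟨1, Finsupp.lsingle 0 ∘ₗ f.hom, g.hom ∘ₗ Finsupp.lapply 0, by ext; simp⟩

/-- A homomorphism from a finitely generated module to a direct sum is the sum of finitely many of
its components. -/
theorem exists_finset_sum_lsingle_lapply [Module.Finite T M] {Λ : Type w}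
    (g : M →ₗ[T] (Λ →₀ X)) :
    ∃ s : Finset Λ, g = ∑ l ∈ s, Finsupp.lsingle l ∘ₗ Finsupp.lapply l ∘ₗ g := by
  classical
  obtain ⟨t, ht⟩ := (Module.Finite.fg_top : (⊤ : Submodule T M).FG)
  refine ⟨t.biUnion fun a => (g a).support, LinearMap.ext_on ht fun a ha => ?_⟩
  refine Finsupp.ext fun l => ?_
  simp only [LinearMap.sum_apply, LinearMap.comp_apply, Finsupp.lapply_apply,
    Finsupp.lsingle_apply, Finsupp.finsetSum_apply, Finsupp.single_apply]
  rw [Finset.sum_ite_eq' _ l fun l => (g a) l]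
  split_ifs with h
  · rfl
  · by_contra hne
    exact h (Finset.mem_biUnion.2 ⟨a, ha, Finsupp.mem_support_iff.2 hne⟩)

/-- A finitely generated source reaches only finitely many copies of `X`. -/
theorem finiteIdeal_eq_infiniteIdeal [Module.Finite T M] :
    finiteIdeal X M B = infiniteIdeal X M B := by
  refine le_antisymm finiteIdeal_le_infiniteIdeal ?_
  rintro f ⟨Λ, g, h, e⟩
  obtain ⟨s, hs⟩ := exists_finset_sum_lsingle_lapply g
  have : f = ∑ l ∈ s, ModuleCat.ofHom (Finsupp.lapply l ∘ₗ g) ≫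
      ModuleCat.ofHom (h ∘ₗ Finsupp.lsingle l) := by
    refine ModuleCat.hom_ext (LinearMap.ext fun a => ?_)
    conv_lhs => rw [e, hs]
    simp [ModuleCat.hom_sum]
  rw [this]
  exact AddSubgroup.sum_mem _ fun l _ => comp_mem_finiteIdeal _ _

/-- Homomorphisms from a direct sum all of whose components factor through finite direct sums of
copies of `X`. -/
theorem exists_factorsThroughCopower_sigma {Λ : Type v}
    (f : ModuleCat.of T (Λ →₀ M) ⟶ B)
    (hf : ∀ l, ModuleCat.ofHom (Finsupp.lsingle l) ≫ f ∈ finiteIdeal X M B) :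
    ∃ n : Λ → ℕ, FactorsThroughCopower X (Σ l, Fin (n l)) f := by
  choose n g h e using hf
  refine ⟨n, Finsupp.lsum ℕ fun l => Finsupp.lmapDomain X T (Sigma.mk l) ∘ₗ g l,
    Finsupp.lsum ℕ fun x => h x.1 ∘ₗ Finsupp.lsingle x.2, ?_⟩
  refine Finsupp.lhom_ext' fun l => ?_
  refine (show f.hom ∘ₗ Finsupp.lsingle l = h l ∘ₗ g l from e l).trans ?_
  refine LinearMap.ext fun m => ?_
  have : ∀ y : Fin (n l) →₀ X, h l y = (Finsupp.lsum ℕ fun x : Σ l, Fin (n l) =>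
      h x.1 ∘ₗ Finsupp.lsingle x.2) (Finsupp.mapDomain (Sigma.mk l) y) := by
    intro y
    induction y using Finsupp.induction_linear with
    | zero => simp
    | add y z hy hz => rw [map_add, Finsupp.mapDomain_add, map_add, hy, hz]
    | single k x => simp
  simpa using this _

end Ideals

/-! ### The trace ideal and part (i) -/

section Trace

variable {R : Type u} [Ring R] {M X B : ModuleCat.{v} Rᵐᵒᵖ}

theorem finiteIdeal_le_of_comp_mem {A : ModuleCat.{v} Rᵐᵒᵖ} {H : AddSubgroup (A ⟶ B)}
    (h : ∀ (f : A ⟶ X) (g : X ⟶ B), f ≫ g ∈ H) : finiteIdeal X A B ≤ H := by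
  rintro f ⟨n, g, k, e⟩
  have : f = ∑ l, ModuleCat.ofHom (Finsupp.lapply l ∘ₗ g) ≫
      ModuleCat.ofHom (k ∘ₗ Finsupp.lsingle l) := by
    refine ModuleCat.hom_ext (LinearMap.ext fun a => ?_)
    have h1 : g a = ∑ l, Finsupp.single l (g a l) := by
      rw [Finsupp.univ_sum_single]
    rw [e]
    simp only [ModuleCat.hom_sum, LinearMap.sum_apply]
    rw [LinearMap.comp_apply, h1, map_sum]
    simp
  rw [this]
  exact AddSubgroup.sum_mem _ fun l _ => h _ _

theorem comp_mem_homTrace (f : M ⟶ X) (g : X ⟶ M) : (f ≫ g : End M) ∈ homTrace M X := by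
  let l : ((preadditiveCoyonedaObj M).obj X) →ₗ[(End M)ᵐᵒᵖ] End M :=
    { toFun := fun p => (p : M ⟶ X) ≫ g
      map_add' := fun p q => Preadditive.add_comp _ _ _ _ _ _
      map_smul' := fun s p => Category.assoc _ _ _ }
  exact Submodule.mem_iSup_of_mem l ⟨f, rfl⟩

/-- A dual basis identity: the `a k` and `b k` are the components of a section and a retraction
between `X` and `M^(Λ)`, and `f` followed by the section meets only finitely many summands. -/
theorem exists_sum_comp_eq [Module.Finite Rᵐᵒᵖ M] (hX : addClosure M X) (f : M ⟶ X) :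
    ∃ (Λ : Type v) (t : Finset Λ) (a : Λ → (X ⟶ M)) (b : Λ → (M ⟶ X)),
      f = ∑ k ∈ t, (f ≫ a k) ≫ b k := by
  obtain ⟨Λ, i, r, h⟩ := addClosure_iff_exists_isRetractOfCopower.1 hX
  obtain ⟨t, ht⟩ := exists_finset_sum_lsingle_lapply (i ∘ₗ f.hom)
  refine ⟨Λ, t, fun k => ModuleCat.ofHom (Finsupp.lapply k ∘ₗ i),
    fun k => ModuleCat.ofHom (r ∘ₗ Finsupp.lsingle k), ModuleCat.hom_ext ?_⟩
  have h2 := congrArg (fun q => r ∘ₗ q) ht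
  simp only [← LinearMap.comp_assoc, h, LinearMap.id_comp] at h2
  conv_lhs => rw [h2]
  ext a
  simp [ModuleCat.hom_sum]

theorem mem_homTrace_iff [Module.Finite Rᵐᵒᵖ M] (hX : addClosure M X) (s : M ⟶ M) :
    s ∈ homTrace M X ↔ s ∈ finiteIdeal X M M := by
  constructor
  · intro hs
    change (s : End M) ∈ rightTrace (End M) ((preadditiveCoyonedaObj M).obj X) at hs
    refine Submodule.iSup_induction _ (motive := fun t : End M => (t : M ⟶ M) ∈ finiteIdeal X M M)
      hs ?_ (AddSubgroup.zero_mem _) fun _ _ => AddSubgroup.add_mem _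
    rintro l _ ⟨p, rfl⟩
    obtain ⟨Λ, t, a, b, hp⟩ := exists_sum_comp_eq hX p
    -- Linearity of `l` over `S` moves the scalar `p ≫ a k` out of `l`, so that every term visibly
    -- passes through `X`.
    have key : l p = ∑ k ∈ t, (p : M ⟶ X) ≫ a k ≫ (l (b k) : M ⟶ M) := by
      conv_lhs => rw [hp]
      refine (map_sum l _ _).trans (Finset.sum_congr rfl fun k _ => ?_)
      exact (l.map_smul (op ((p : M ⟶ X) ≫ a k : End M)) _).trans (Category.assoc _ _ _)
    rw [key]
    exact AddSubgroup.sum_mem _ fun k _ => comp_mem_finiteIdeal _ _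
  · intro hs
    exact finiteIdeal_le_of_comp_mem (H := (homTrace M X).toAddSubgroup)
      (fun f g => comp_mem_homTrace f g) hs

theorem infiniteIdeal_eq_homMulIdeal [Module.Finite Rᵐᵒᵖ M] (hX : addClosure M X) :
    infiniteIdeal X M B = homMulIdeal M B (homTrace M X) := by
  rw [← finiteIdeal_eq_infiniteIdeal]
  apply le_antisymm
  · refine finiteIdeal_le_of_comp_mem fun f g => ?_
    obtain ⟨Λ, t, a, b, hp⟩ := exists_sum_comp_eq hX f
    have key : f ≫ g = ∑ k ∈ t, (f ≫ a k) ≫ b k ≫ g := by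
      conv_lhs => rw [hp]
      simp [Preadditive.sum_comp]
    rw [key]
    exact AddSubgroup.sum_mem _ fun k _ =>
      AddSubgroup.subset_closure ⟨_, _, comp_mem_homTrace _ _, rfl⟩
  · refine (AddSubgroup.closure_le _).2 ?_
    rintro _ ⟨f, s, hs, rfl⟩
    exact finiteIdeal_comp_left _ ((mem_homTrace_iff hX s).1 hs)

end Trace

/-! ### The tensor product with `S/I` as the quotient `P / P I` -/

section BalancedTensor

variable {S : Type*} [Ring S] (I : Ideal S) [I.IsTwoSided] {P : Type*} [AddCommGroup P]
  [Module Sᵐᵒᵖ P]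

/-- The element `p ⊗ 1` of `P ⊗_S S/I`. -/
def balancedMk : P →+ BalancedTensor S (S ⧸ I) (S ⧸ I) P where
  toFun p := Submodule.Quotient.mk ((1 : S ⧸ I) ⊗ₜ[ℤ] p)
  map_zero' := by rw [TensorProduct.tmul_zero, Submodule.Quotient.mk_zero]
  map_add' p q := by rw [TensorProduct.tmul_add, Submodule.Quotient.mk_add]

theorem mk_tmul_eq_balancedMk (s : S) (p : P) :
    (Submodule.Quotient.mk ((Ideal.Quotient.mk I s) ⊗ₜ[ℤ] p) :
      BalancedTensor S (S ⧸ I) (S ⧸ I) P) = balancedMk I (op s • p) := by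
  symm
  refine (Submodule.Quotient.eq _).2 (Submodule.subset_span ⟨1, s, p, ?_⟩)
  have : s • (1 : S ⧸ I) = Ideal.Quotient.mk I s := by
    change Ideal.Quotient.mk I (s * 1) = _
    rw [mul_one]
  rw [this]

theorem balancedMk_surjective : Function.Surjective (balancedMk I (P := P)) := by
  intro x
  obtain ⟨x, rfl⟩ := Submodule.Quotient.mk_surjective _ x
  induction x using TensorProduct.induction_on with
  | zero => exact ⟨0, map_zero _⟩
  | tmul n p =>
    obtain ⟨s, rfl⟩ := Ideal.Quotient.mk_surjective n
    exact ⟨_, (mk_tmul_eq_balancedMk I s p).symm⟩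
  | add x y hx hy =>
    obtain ⟨p, hp⟩ := hx
    obtain ⟨q, hq⟩ := hy
    exact ⟨p + q, by rw [map_add, hp, hq]; rfl⟩

theorem op_smul_balancedMk (s : S) (p : P) :
    op (Ideal.Quotient.mk I s) • balancedMk I p = balancedMk I (op s • p) := by
  refine Eq.trans ?_ (mk_tmul_eq_balancedMk I s p)
  change Submodule.Quotient.mk ((1 * Ideal.Quotient.mk I s) ⊗ₜ[ℤ] p) = _
  rw [one_mul]

/-- The subgroup `P I` of a right module `P`. -/
def rightMulIdeal (P : Type*) [AddCommGroup P] [Module Sᵐᵒᵖ P] : AddSubgroup P :=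
  AddSubgroup.closure {q | ∃ (p : P) (s : S), s ∈ I ∧ q = op s • p}

/-- The homomorphism `p ⊗ s ↦ p s` from `P ⊗_ℤ S/I` to `P / P I`. -/
def tensorToQuotient : ((S ⧸ I) ⊗[ℤ] P) →+ P ⧸ rightMulIdeal I P :=
  TensorProduct.liftAddHom
    (QuotientAddGroup.lift (Submodule.toAddSubgroup I)
      { toFun := fun s : S => (QuotientAddGroup.mk' (rightMulIdeal I P)).comp
          (DistribSMul.toAddMonoidHom P (op s))
        map_zero' := by
          ext p
          simp
        map_add' := fun s t => by
          ext p
          simp [add_smul] }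
      (fun s hs => by
        ext p
        exact (QuotientAddGroup.eq_zero_iff _).2 (AddSubgroup.subset_closure ⟨p, s, hs, rfl⟩)))
    (fun r m n => (DFunLike.congr_fun (map_zsmul _ r m) n).trans (map_zsmul _ r n).symm)

theorem tensorToQuotient_tmul (s : S) (p : P) :
    tensorToQuotient I ((Ideal.Quotient.mk I s) ⊗ₜ[ℤ] p) =
      QuotientAddGroup.mk' (rightMulIdeal I P) (op s • p) := rfl

theorem tensorToQuotient_eq_zero (t : (S ⧸ I) ⊗[ℤ] P)
    (ht : t ∈ balancedRelations S (S ⧸ I) (S ⧸ I) P) : tensorToQuotient I t = 0 := by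
  -- `tensorToQuotient` is only additive, whereas the relations are spanned over `(S/I)ᵐᵒᵖ`;
  -- quantifying over `u` makes the claim stable under scalars.
  suffices h : ∀ u : (S ⧸ I)ᵐᵒᵖ, tensorToQuotient I (u • t) = 0 by
    simpa using h 1
  refine Submodule.span_induction (p := fun t _ => ∀ u : (S ⧸ I)ᵐᵒᵖ,
    tensorToQuotient I (u • t) = 0) ?_ ?_ ?_ ?_ ht
  · rintro _ ⟨n, s, p, rfl⟩ u
    obtain ⟨n, rfl⟩ := Ideal.Quotient.mk_surjective n
    obtain ⟨u, rfl⟩ := op_surjective u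
    obtain ⟨u, rfl⟩ := Ideal.Quotient.mk_surjective u
    rw [smul_sub, map_sub, sub_eq_zero]
    refine (tensorToQuotient_tmul I (n * u) (op s • p)).trans
      (Eq.trans ?_ (tensorToQuotient_tmul I (s * n * u) p).symm)
    rw [smul_smul, ← op_mul, mul_assoc]
  · intro u
    rw [smul_zero, map_zero]
  · intro x y _ _ hx hy u
    rw [smul_add, map_add, hx, hy, add_zero]
  · intro a x _ hx u
    rw [smul_smul]
    exact hx _

theorem balancedMk_eq_zero_iff (p : P) : balancedMk I p = 0 ↔ p ∈ rightMulIdeal I P := by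
  constructor
  · intro h
    have := tensorToQuotient_eq_zero I _ ((Submodule.Quotient.mk_eq_zero _).1 h)
    rw [← (QuotientAddGroup.eq_zero_iff p), ← this]
    refine ((tensorToQuotient_tmul I 1 p).trans ?_).symm
    rw [op_one, one_smul]
    rfl
  · intro h
    have : rightMulIdeal I P ≤ (balancedMk I).ker := by
      refine (AddSubgroup.closure_le _).2 ?_
      rintro _ ⟨f, s, hs, rfl⟩
      change balancedMk I (op s • f) = 0
      rw [← op_smul_balancedMk, Ideal.Quotient.eq_zero_iff_mem.2 hs, op_zero, zero_smul]
    exact this h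

end BalancedTensor

/-! ### The functor in terms of classes of maps from `M` -/

section HomTensor

variable {R : Type u} [Ring R] {M : ModuleCat.{v} Rᵐᵒᵖ} (I : Ideal (End M)) [I.IsTwoSided]
  {A B : ModuleCat.{v} Rᵐᵒᵖ}

/-- The element `p ⊗ 1` of `Hom_R(M, B) ⊗_S S/I`. -/
def homTensorMk : (M ⟶ B) →+ (homTensor M I).obj B :=
  let f : (preadditiveCoyonedaObj M).obj B →+ BalancedTensor (End M) (End M ⧸ I) (End M ⧸ I)
    ((preadditiveCoyonedaObj M).obj B) := balancedMk I
  f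

theorem homTensorMk_surjective : Function.Surjective (homTensorMk I (B := B)) :=
  balancedMk_surjective I

theorem op_smul_homTensorMk (s : End M) (p : M ⟶ B) :
    op (Ideal.Quotient.mk I s) • homTensorMk I p = homTensorMk I ((s : M ⟶ M) ≫ p) :=
  op_smul_balancedMk I (P := (preadditiveCoyonedaObj M).obj B) s p

theorem homTensorMk_eq_zero_iff (p : M ⟶ B) :
    homTensorMk I p = 0 ↔ p ∈ homMulIdeal M B I :=
  balancedMk_eq_zero_iff I (P := (preadditiveCoyonedaObj M).obj B) p

theorem homTensor_map_homTensorMk (f : A ⟶ B) (p : M ⟶ A) :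
    ((homTensor M I).map f).hom (homTensorMk I p) = homTensorMk I (p ≫ f) := rfl

theorem homTensor_hom_ext {N : ModuleCat.{v} (End M ⧸ I)ᵐᵒᵖ} {f g : (homTensor M I).obj A ⟶ N}
    (h : ∀ p : M ⟶ A, f.hom (homTensorMk I p) = g.hom (homTensorMk I p)) : f = g := by
  refine ModuleCat.hom_ext (LinearMap.ext fun x => ?_)
  obtain ⟨p, rfl⟩ := homTensorMk_surjective I x
  exact h p

instance homTensor_additive : (homTensor M I).Additive where
  map_add {A B f g} := homTensor_hom_ext I fun p => by
    change homTensorMk I (p ≫ (f + g)) = homTensorMk I (p ≫ f) + homTensorMk I (p ≫ g)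
    rw [Preadditive.comp_add, map_add]

end HomTensor

/-! ### Splitting an idempotent of the quotient by a shift argument -/

section LiftIdempotent

variable {C : Type*} [Category* C] [Preadditive C] [IsIdempotentComplete C]
  {D : Type*} [Category* D] [Preadditive D]

/-- An idempotent in the image of an additive functor `F` splits through the image of an object, if
the object `L` it lives on is the first of the summands of an object `N` that is isomorphic to
`L ⊕ N`, and the obstruction to its being an idempotent factors through an object `Y` that is
killed by `F`. The object `B` is a biproduct of `N` and `Y`. -/
theorem exists_splitting_of_map_idempotent (F : C ⥤ D) [F.Additive] {L N Y B : C}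
    {ι : L ⟶ N} {π : N ⟶ L} {up down e : N ⟶ N} {ε : L ⟶ L} {g : N ⟶ Y} {h : Y ⟶ N}
    {inl : N ⟶ B} {inr : Y ⟶ B} {fst : B ⟶ N} {snd : B ⟶ Y}
    (ιπ : ι ≫ π = 𝟙 L) (ud : up ≫ down = 𝟙 N) (du : down ≫ up = 𝟙 N - π ≫ ι)
    (eu : up ≫ e = e ≫ up) (ed : down ≫ e = e ≫ down)
    (eπ : e ≫ π = π ≫ ε) (gh : g ≫ h = e - e ≫ e)
    (inl_fst : inl ≫ fst = 𝟙 N) (inl_snd : inl ≫ snd = 0) (inr_fst : inr ≫ fst = 0)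
    (inr_snd : inr ≫ snd = 𝟙 Y) (total : fst ≫ inl + snd ≫ inr = 𝟙 B)
    (hY : F.map (𝟙 Y) = 0) (hε : F.map ε ≫ F.map ε = F.map ε) :
    ∃ (A : C) (i : A ⟶ B) (r : B ⟶ A) (u : A ⟶ L) (w : L ⟶ A), i ≫ r = 𝟙 A ∧
      F.map w ≫ F.map u = F.map ε ∧ F.map u ≫ F.map w = 𝟙 (F.obj A) := by
  have to_zero : ∀ {Z : C} (f : Z ⟶ Y), F.map f = 0 := fun f => by
    rw [← Category.comp_id f, F.map_comp, hY, Limits.comp_zero]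
  have from_zero : ∀ {Z : C} (f : Y ⟶ Z), F.map f = 0 := fun f => by
    rw [← Category.id_comp f, F.map_comp, hY, Limits.zero_comp]
  have ιd : ι ≫ down = 0 := by
    have h1 : ι ≫ (down ≫ up) ≫ down = 0 := by
      rw [du, Preadditive.sub_comp, Preadditive.comp_sub, Category.assoc, reassoc_of% ιπ,
        Category.id_comp, sub_self]
    rwa [Category.assoc, ud, Category.comp_id] at h1
  have uπ : up ≫ π = 0 := by
    have h1 : up ≫ (down ≫ up) ≫ π = 0 := by
      rw [du, Preadditive.sub_comp, Preadditive.comp_sub, Category.assoc, ιπ,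
        Category.comp_id, Category.id_comp, sub_self]
    rwa [Category.assoc, reassoc_of% ud] at h1
  -- Where `e` acts as zero, `s` and `p` are the identity; where it acts as one, they are the
  -- shifts. Expanding `s ≫ p` leaves the error `(2 - up - down) ≫ (e - e ≫ e)`, which `g' ≫ h`
  -- accounts for.
  let s : N ⟶ N := 𝟙 N - e + e ≫ up
  let p : N ⟶ N := 𝟙 N - e + e ≫ down
  let g' : N ⟶ Y := g + g - up ≫ g - down ≫ g
  have sp : s ≫ p + g' ≫ h = 𝟙 N := by
    simp only [s, p, g', Preadditive.add_comp, Preadditive.sub_comp, Preadditive.comp_add,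
      Preadditive.comp_sub, Category.assoc, Category.comp_id, Category.id_comp, gh, eu, ed,
      reassoc_of% eu, reassoc_of% ed, ud]
    abel
  have ps : p ≫ s = 𝟙 N - g' ≫ h - π ≫ ε ≫ ε ≫ ι := by
    simp only [s, p, g', Preadditive.add_comp, Preadditive.sub_comp, Preadditive.comp_add,
      Preadditive.comp_sub, Category.assoc, Category.comp_id, Category.id_comp, gh, eu, ed,
      reassoc_of% eu, reassoc_of% ed, du, reassoc_of% eπ]
    abel
  let s' : N ⟶ B := s ≫ inl + g' ≫ inr
  let p' : B ⟶ N := fst ≫ p + snd ≫ h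
  have sp' : s' ≫ p' = 𝟙 N := by
    simp only [s', p', Preadditive.add_comp, Preadditive.comp_add, Category.assoc,
      reassoc_of% inl_fst, reassoc_of% inl_snd, reassoc_of% inr_fst, reassoc_of% inr_snd,
      Limits.zero_comp, Limits.comp_zero, add_zero, zero_add, sp]
  -- `s'` and `p'` make `N` a summand of `B`; `A` is the complementary summand.
  obtain ⟨A, j, q, jq, qj⟩ := IsIdempotentComplete.idempotents_split B (𝟙 B - p' ≫ s') (by
    simp only [Preadditive.sub_comp, Preadditive.comp_sub, Category.assoc, Category.comp_id,
      Category.id_comp, reassoc_of% sp']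
    abel)
  have map_ps : F.map p ≫ F.map s = 𝟙 _ - F.map π ≫ F.map ε ≫ F.map ι := by
    rw [← F.map_comp, ps]
    simp only [Functor.map_sub, Functor.map_comp, F.map_id, from_zero h, Limits.comp_zero,
      sub_zero, reassoc_of% hε]
  have map_qj : F.map (q ≫ j) = F.map (fst ≫ π ≫ ε ≫ ι ≫ inl) := by
    rw [qj, ← total]
    simp only [s', p', Functor.map_sub, Functor.map_add, Functor.map_comp, from_zero, to_zero,
      Limits.comp_zero, add_zero, Category.assoc, reassoc_of% map_ps,
      Preadditive.sub_comp, Preadditive.comp_sub, Category.id_comp, sub_sub_cancel]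
  refine ⟨A, j, q, j ≫ fst ≫ π, ι ≫ inl ≫ q, jq, ?_, ?_⟩
  -- Before `F` is applied the composite is `2ε - ε²`, which `F` identifies with `ε`.
  · have h1 : ι ≫ inl ≫ (q ≫ j) ≫ fst ≫ π = ε + ε - ε ≫ ε := by
      rw [qj]
      simp only [s', p', s, p, Preadditive.sub_comp, Preadditive.comp_sub, Preadditive.add_comp,
        Preadditive.comp_add, Category.assoc,
        Category.id_comp, Category.comp_id, reassoc_of% inl_fst,
        reassoc_of% inl_snd, reassoc_of% inr_fst, reassoc_of% uπ, reassoc_of% ιd, eπ, reassoc_of% eπ,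
        reassoc_of% ιπ, ιπ, ← eu, ← ed, Limits.comp_zero, Limits.zero_comp]
      abel
    rw [← F.map_comp]
    have h2 : (ι ≫ inl ≫ q) ≫ j ≫ fst ≫ π = ι ≫ inl ≫ (q ≫ j) ≫ fst ≫ π := by
      simp only [Category.assoc]
    rw [h2, h1, F.map_sub, F.map_add, F.map_comp, hε, add_sub_cancel_right]
  -- After `F`, the idempotent `q ≫ j` becomes `ε` on coordinate zero of `N`, where projecting to
  -- that coordinate and including it back changes nothing.
  · have h1 : F.map ((q ≫ j) ≫ (fst ≫ π ≫ ι ≫ inl) ≫ (q ≫ j)) = F.map (q ≫ j) := by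
      rw [F.map_comp (q ≫ j), F.map_comp _ (q ≫ j), map_qj, ← F.map_comp, ← F.map_comp]
      simp only [Category.assoc, reassoc_of% inl_fst, reassoc_of% ιπ]
      simp only [Functor.map_comp, reassoc_of% hε]
    have h2 : (j ≫ fst ≫ π) ≫ ι ≫ inl ≫ q =
        j ≫ ((q ≫ j) ≫ (fst ≫ π ≫ ι ≫ inl) ≫ (q ≫ j)) ≫ q := by
      simp only [Category.assoc, jq, reassoc_of% jq, Category.comp_id]
    rw [← F.map_comp, h2, F.map_comp, F.map_comp, h1, ← F.map_comp, ← F.map_comp,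
      Category.assoc, jq, Category.comp_id, jq, F.map_id]

end LiftIdempotent

/-! ### Faithfulness modulo `𝓙_X` and fullness -/

section Equivalence

variable {R : Type u} [Ring R] {M X : ModuleCat.{v} Rᵐᵒᵖ} [Module.Finite Rᵐᵒᵖ M]
  {A B : ModuleCat.{v} Rᵐᵒᵖ}

theorem homTensor_map_eq_zero_of_mem (hX : addClosure M X) {f : A ⟶ B}
    (hf : f ∈ infiniteIdeal X A B) : (homTensor M (homTrace M X)).map f = 0 := by
  refine homTensor_hom_ext _ fun p => ?_
  refine (homTensorMk_eq_zero_iff _ (p ≫ f)).2 ?_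
  rw [← infiniteIdeal_eq_homMulIdeal hX]
  exact infiniteIdeal_comp_right p hf

/-- By (i), each component on a copy of `M` factors through a finite power of `X`. The index set is
kept explicit because it is countable when `Λ` is. -/
theorem exists_factorsThroughCopower_of_map_eq_zero (hX : addClosure M X) {Λ : Type v}
    {f : ModuleCat.of Rᵐᵒᵖ (Λ →₀ M) ⟶ B} (hf : (homTensor M (homTrace M X)).map f = 0) :
    ∃ n : Λ → ℕ, FactorsThroughCopower X (Σ l, Fin (n l)) f := by
  refine exists_factorsThroughCopower_sigma f fun l => ?_
  rw [finiteIdeal_eq_infiniteIdeal, infiniteIdeal_eq_homMulIdeal hX, ← homTensorMk_eq_zero_iff,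
    ← homTensor_map_homTensorMk, hf]
  rfl

theorem homTensor_map_eq_zero_iff (hX : addClosure M X) (hA : addClosure M A) {f : A ⟶ B} :
    (homTensor M (homTrace M X)).map f = 0 ↔ f ∈ infiniteIdeal X A B := by
  refine ⟨fun hf => ?_, homTensor_map_eq_zero_of_mem hX⟩
  obtain ⟨Λ, i, r, h⟩ := addClosure_iff_exists_isRetractOfCopower.1 hA
  have h1 : f = ModuleCat.ofHom i ≫ ModuleCat.ofHom r ≫ f := by
    rw [← Category.assoc, ← ModuleCat.ofHom_comp, h]
    rfl
  obtain ⟨n, hn⟩ := exists_factorsThroughCopower_of_map_eq_zero hX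
    (f := ModuleCat.ofHom r ≫ f) (by rw [Functor.map_comp, hf, Limits.comp_zero])
  rw [h1]
  exact infiniteIdeal_comp_right _ ⟨_, hn⟩

section Free

variable (I : Ideal (End M)) [I.IsTwoSided]

theorem homTensorMk_eq_sum {Λ : Type v} (p : M ⟶ ModuleCat.of Rᵐᵒᵖ (Λ →₀ M)) :
    ∃ (t : Finset Λ) (s : Λ → End M), homTensorMk I p = ∑ l ∈ t, op (Ideal.Quotient.mk I (s l)) •
      homTensorMk I (ModuleCat.ofHom (Finsupp.lsingle l) : M ⟶ ModuleCat.of Rᵐᵒᵖ (Λ →₀ M)) := by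
  obtain ⟨t, ht⟩ := exists_finset_sum_lsingle_lapply p.hom
  refine ⟨t, fun l => ModuleCat.ofHom (Finsupp.lapply l ∘ₗ p.hom), ?_⟩
  simp_rw [op_smul_homTensorMk]
  rw [← map_sum]
  refine congrArg _ (ModuleCat.hom_ext ?_)
  rw [ModuleCat.hom_sum]
  exact ht

/-- `F(M^(Λ))` is generated by the classes of the inclusions of `M`. Their images lift to maps `M ⟶
B`, which assemble to a map on `M^(Λ)`; the general case follows by restricting along a section. -/
theorem homTensor_full (hA : addClosure M A) (φ : (homTensor M I).obj A ⟶ (homTensor M I).obj B) :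
    ∃ f : A ⟶ B, (homTensor M I).map f = φ := by
  obtain ⟨Λ, i, r, h⟩ := addClosure_iff_exists_isRetractOfCopower.1 hA
  choose f hf using fun l : Λ => homTensorMk_surjective I (((homTensor M I).map
    (ModuleCat.ofHom r) ≫ φ).hom (homTensorMk I (ModuleCat.ofHom (Finsupp.lsingle l))))
  let f' : ModuleCat.of Rᵐᵒᵖ (Λ →₀ M) ⟶ B := ModuleCat.ofHom (Finsupp.lsum ℕ fun l => (f l).hom)
  have hf' : ∀ l, ModuleCat.ofHom (Finsupp.lsingle l) ≫ f' = f l := fun l => by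
    refine ModuleCat.hom_ext (LinearMap.ext fun x => ?_)
    simp [f']
  have key : (homTensor M I).map f' = (homTensor M I).map (ModuleCat.ofHom r) ≫ φ := by
    refine homTensor_hom_ext _ fun p => ?_
    obtain ⟨t, s, hp⟩ := homTensorMk_eq_sum I p
    rw [hp, map_sum, map_sum]
    refine Finset.sum_congr rfl fun l _ => ?_
    rw [map_smul, map_smul, ← hf l, homTensor_map_homTensorMk, hf']
  refine ⟨ModuleCat.ofHom i ≫ f', ?_⟩
  rw [Functor.map_comp, key, ← Category.assoc, ← Functor.map_comp, ← ModuleCat.ofHom_comp, h]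
  exact (congrArg (· ≫ φ) ((homTensor M I).map_id A)).trans (Category.id_comp φ)

end Free

end Equivalence

/-! ### The shifts of `L^(ℕ)` -/

section Shift

variable (T : Type u) [Ring T] (L : Type v) [AddCommGroup L] [Module T L]

/-- The shift `x ↦ (0, x 0, x 1, …)` of sequences. -/
noncomputable def shiftUp : (ℕ →₀ L) →ₗ[T] (ℕ →₀ L) := Finsupp.lmapDomain L T Nat.succ

/-- The shift `x ↦ (x 1, x 2, …)` of sequences. -/
noncomputable def shiftDown : (ℕ →₀ L) →ₗ[T] (ℕ →₀ L) :=
  Finsupp.lcomapDomain Nat.succ Nat.succ_injective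

variable {T L}

@[simp]
theorem shiftUp_zero (x : ℕ →₀ L) : shiftUp T L x 0 = 0 :=
  Finsupp.mapDomain_of_notMem_range _ _ (by simp)

@[simp]
theorem shiftUp_succ (x : ℕ →₀ L) (n : ℕ) : shiftUp T L x (n + 1) = x n :=
  Finsupp.mapDomain_apply Nat.succ_injective _ _

@[simp]
theorem shiftDown_apply (x : ℕ →₀ L) (n : ℕ) : shiftDown T L x n = x (n + 1) := rfl

theorem shiftDown_comp_shiftUp : shiftDown T L ∘ₗ shiftUp T L = LinearMap.id :=
  LinearMap.ext fun x => Finsupp.ext fun k => by simp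

theorem shiftUp_comp_shiftDown : shiftUp T L ∘ₗ shiftDown T L =
    LinearMap.id - Finsupp.lsingle 0 ∘ₗ Finsupp.lapply 0 :=
  LinearMap.ext fun x => Finsupp.ext fun k => by cases k <;> simp

theorem mapRange_comp_shiftUp (f : L →ₗ[T] L) :
    Finsupp.mapRange.linearMap f ∘ₗ shiftUp T L = shiftUp T L ∘ₗ Finsupp.mapRange.linearMap f :=
  LinearMap.ext fun x => Finsupp.ext fun k => by cases k <;> simp

theorem mapRange_comp_shiftDown (f : L →ₗ[T] L) :
    Finsupp.mapRange.linearMap f ∘ₗ shiftDown T L =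
      shiftDown T L ∘ₗ Finsupp.mapRange.linearMap f :=
  LinearMap.ext fun x => Finsupp.ext fun k => by simp

end Shift

/-! ### Free and projective modules over `S/I` -/

section Free

variable {R : Type u} [Ring R] {M : ModuleCat.{v} Rᵐᵒᵖ}

/-- The homomorphism of right modules `S/I → N` that maps `1` to `x`. -/
def rightToSpan {S : Type*} [Ring S] {N : Type*} [AddCommGroup N] [Module Sᵐᵒᵖ N] (x : N) :
    S →ₗ[Sᵐᵒᵖ] N where
  toFun s := op s • x
  map_add' s t := by rw [MulOpposite.op_add, add_smul]
  map_smul' s t := by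
    rw [RingHom.id_apply, smul_smul]
    rfl

/-- A ring as a right module over itself is free. -/
def rightRegularEquiv (S : Type*) [Ring S] : Sᵐᵒᵖ ≃ₗ[Sᵐᵒᵖ] S :=
  { (opAddEquiv.symm : Sᵐᵒᵖ ≃+ S) with
    map_smul' := fun _ _ => rfl }

theorem projective_iff_addClosure (S : Type v) [Ring S] (N : ModuleCat.{v} Sᵐᵒᵖ) :
    Module.Projective Sᵐᵒᵖ N ↔ addClosure (ModuleCat.of Sᵐᵒᵖ S) N := by
  rw [addClosure_iff_exists_isRetractOfCopower]
  constructor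
  · intro h
    obtain ⟨i, hi⟩ := Module.projective_def'.1 h
    let E : (N →₀ Sᵐᵒᵖ) ≃ₗ[Sᵐᵒᵖ] (N →₀ S) := Finsupp.mapRange.linearEquiv (rightRegularEquiv S)
    refine ⟨N, E.toLinearMap ∘ₗ i, Finsupp.linearCombination Sᵐᵒᵖ id ∘ₗ E.symm.toLinearMap, ?_⟩
    rw [LinearMap.comp_assoc, ← LinearMap.comp_assoc i, LinearEquiv.symm_comp,
      LinearMap.id_comp, hi]
  · rintro ⟨Λ, i, r, h⟩
    have : Module.Projective Sᵐᵒᵖ S := Module.Projective.of_equiv (rightRegularEquiv S)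
    have : Module.Projective Sᵐᵒᵖ (Λ →₀ S) :=
      Module.Projective.of_equiv (Finsupp.mapRange.linearEquiv (α := Λ) (rightRegularEquiv S))
    exact Module.Projective.of_split (M := Λ →₀ S) i r h

theorem countableProjective_eq (S : Type v) [Ring S] :
    countableProjective Sᵐᵒᵖ = countableAddClosure (ModuleCat.of Sᵐᵒᵖ S) := by
  ext N
  exact and_congr_left fun _ => projective_iff_addClosure S N

instance finite_rightRegular (S : Type v) [Ring S] :
    Module.Finite Sᵐᵒᵖ (ModuleCat.of Sᵐᵒᵖ S) :=
  Module.Finite.equiv (rightRegularEquiv S)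

variable [Module.Finite Rᵐᵒᵖ M] {X : ModuleCat.{v} Rᵐᵒᵖ}

/-- The functor `Hom_R(M, -) ⊗_S S/I` maps `M^(Λ)` to `(S/I)^(Λ)`. -/
theorem nonempty_homTensor_copower_equiv (hX : addClosure M X) (Λ : Type v) :
    Nonempty ((homTensor M (homTrace M X)).obj (ModuleCat.of Rᵐᵒᵖ (Λ →₀ M))
      ≃ₗ[(End M ⧸ homTrace M X)ᵐᵒᵖ] (Λ →₀ (End M ⧸ homTrace M X))) := by
  let I := homTrace M X
  let e : Λ → (homTensor M I).obj (ModuleCat.of Rᵐᵒᵖ (Λ →₀ M)) := fun l =>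
    homTensorMk I (ModuleCat.ofHom (Finsupp.lsingle l))
  let φ : (Λ →₀ (End M ⧸ I)) →ₗ[(End M ⧸ I)ᵐᵒᵖ]
      (homTensor M I).obj (ModuleCat.of Rᵐᵒᵖ (Λ →₀ M)) :=
    Finsupp.lsum ℕ fun l => rightToSpan (e l)
  have hφ : ∀ l x, φ (Finsupp.single l x) = op x • e l := fun l x =>
    Finsupp.lsum_single _ _ _ _
  refine ⟨(LinearEquiv.ofBijective φ ⟨?_, ?_⟩).symm⟩
  · rw [injective_iff_map_eq_zero]
    intro x hx
    choose s hs using fun l => Ideal.Quotient.mk_surjective (x l)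
    have h1 : φ x = homTensorMk I
        (∑ l ∈ x.support, (s l : M ⟶ M) ≫ ModuleCat.ofHom (Finsupp.lsingle l)) := by
      conv_lhs => rw [← Finsupp.sum_single x, Finsupp.sum, map_sum]
      rw [map_sum]
      refine Finset.sum_congr rfl fun l _ => ?_
      rw [hφ, ← hs, op_smul_homTensorMk]
    rw [h1, homTensorMk_eq_zero_iff, ← infiniteIdeal_eq_homMulIdeal hX,
      ← finiteIdeal_eq_infiniteIdeal] at hx
    refine Finsupp.ext fun k => ?_
    by_contra hk
    -- Projecting to coordinate `k` puts the lift `s k` into `𝓘_X(M, M) = I`, so its class `x k`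
    -- vanishes.
    have h2 := finiteIdeal_comp_left (ModuleCat.ofHom (Finsupp.lapply k)) hx
    have h3 : (∑ l ∈ x.support, (s l : M ⟶ M) ≫ ModuleCat.ofHom (Finsupp.lsingle l)) ≫
        ModuleCat.ofHom (Finsupp.lapply k) = (s k : M ⟶ M) := by
      refine ModuleCat.hom_ext (LinearMap.ext fun m => ?_)
      rw [Preadditive.sum_comp, ModuleCat.hom_sum, LinearMap.sum_apply, Finset.sum_eq_single k]
      · simp
      · intro l _ hl
        simp [Finsupp.single_eq_of_ne hl.symm]
      · intro h
        exact absurd (Finsupp.mem_support_iff.2 hk) h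
    rw [h3] at h2
    exact hk ((hs k).symm.trans (Ideal.Quotient.eq_zero_iff_mem.2 ((mem_homTrace_iff hX _).2 h2)))
  · intro y
    obtain ⟨p, rfl⟩ := homTensorMk_surjective I y
    obtain ⟨t, s, h⟩ := homTensorMk_eq_sum I p
    refine ⟨∑ l ∈ t, Finsupp.single l (Ideal.Quotient.mk I (s l)), ?_⟩
    rw [h, map_sum]
    exact Finset.sum_congr rfl fun l _ => hφ _ _

theorem IsRetractOfCopower.homTensor (hX : addClosure M X) {Λ : Type v} {A : ModuleCat.{v} Rᵐᵒᵖ}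
    (hA : IsRetractOfCopower M Λ A) :
    IsRetractOfCopower (ModuleCat.of (End M ⧸ homTrace M X)ᵐᵒᵖ (End M ⧸ homTrace M X)) Λ
      ((homTensor M (homTrace M X)).obj A) := by
  obtain ⟨i, r, h⟩ := hA
  obtain ⟨e⟩ := nonempty_homTensor_copower_equiv hX Λ
  refine (IsRetractOfCopower.of_linearEquiv (A := (TraceQuotient.homTensor M (homTrace M X)).obj
    (ModuleCat.of Rᵐᵒᵖ (Λ →₀ M))) e).of_retract
    ((TraceQuotient.homTensor M (homTrace M X)).map (ModuleCat.ofHom i)).hom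
    ((TraceQuotient.homTensor M (homTrace M X)).map (ModuleCat.ofHom r)).hom ?_
  rw [← ModuleCat.hom_comp, ← Functor.map_comp, ← ModuleCat.ofHom_comp, h]
  exact congrArg ModuleCat.Hom.hom ((TraceQuotient.homTensor M (homTrace M X)).map_id A)

end Free

/-! ### Density of the functor -/

section EssSurj

variable {R : Type u} [Ring R] {M X : ModuleCat.{v} Rᵐᵒᵖ} [Module.Finite Rᵐᵒᵖ M]

/-- The summand `A` of `L^(ℕ) ⊕ Y` comes from the shift argument. The index set records the copies
of `M` needed for `L^(ℕ)` and for `Y`, so one statement serves both (ii) and (iii). -/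
theorem exists_iso_of_isRetractOfCopower {Λ Λ' : Type v} (hX : IsRetractOfCopower M Λ' X)
    {N : ModuleCat.{v} (End M ⧸ homTrace M X)ᵐᵒᵖ}
    (hN : IsRetractOfCopower (ModuleCat.of (End M ⧸ homTrace M X)ᵐᵒᵖ (End M ⧸ homTrace M X)) Λ N) :
    ∃ (n : Λ → ℕ) (A : ModuleCat.{v} Rᵐᵒᵖ),
      IsRetractOfCopower M ((ℕ × Λ) ⊕ ((ℕ × (Σ l, Fin (n l))) × Λ')) A ∧
      Nonempty ((homTensor M (homTrace M X)).obj A ≅ N) := by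
  have hX' : addClosure M X := addClosure_iff_exists_isRetractOfCopower.2 ⟨Λ', hX⟩
  let F := homTensor M (homTrace M X)
  let L : ModuleCat.{v} Rᵐᵒᵖ := ModuleCat.of Rᵐᵒᵖ (Λ →₀ M)
  have hL : addClosure M L := addClosure_iff_exists_isRetractOfCopower.2
    ⟨Λ, .of_linearEquiv (LinearEquiv.refl _ _)⟩
  obtain ⟨i, r, hir⟩ : ∃ (i : N ⟶ F.obj L) (r : F.obj L ⟶ N), i ≫ r = 𝟙 N := by
    obtain ⟨i, r, h⟩ := hN
    obtain ⟨E⟩ := nonempty_homTensor_copower_equiv hX' Λ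
    refine ⟨ModuleCat.ofHom (E.symm.toLinearMap ∘ₗ i), ModuleCat.ofHom (r ∘ₗ E.toLinearMap), ?_⟩
    refine ModuleCat.hom_ext (LinearMap.ext fun x => ?_)
    exact (congrArg r (E.apply_symm_apply (i x))).trans (LinearMap.congr_fun h x)
  -- `r ≫ i` is the idempotent of `F(L)` with image `N`; its lift `ε` is idempotent only modulo
  -- `𝓙_X`.
  obtain ⟨ε, hε⟩ := homTensor_full (homTrace M X) hL (r ≫ i)
  have hεε : F.map ε ≫ F.map ε = F.map ε := by
    rw [hε, Category.assoc, reassoc_of% hir]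
  obtain ⟨n, g, h, hgh⟩ := exists_factorsThroughCopower_of_map_eq_zero hX' (f := ε - ε ≫ ε)
    (by rw [Functor.map_sub, Functor.map_comp, hεε, sub_self])
  let K := Σ l, Fin (n l)
  let c : ((ℕ × K) →₀ X) ≃ₗ[Rᵐᵒᵖ] (ℕ →₀ K →₀ X) := Finsupp.curryLinearEquiv Rᵐᵒᵖ
  let Y : ModuleCat.{v} Rᵐᵒᵖ := ModuleCat.of Rᵐᵒᵖ ((ℕ × K) →₀ X)
  let W : ModuleCat.{v} Rᵐᵒᵖ := ModuleCat.of Rᵐᵒᵖ (ℕ →₀ L)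
  have hW : IsRetractOfCopower M (ℕ × Λ) W :=
    .of_linearEquiv (Finsupp.curryLinearEquiv Rᵐᵒᵖ).symm
  obtain ⟨A, j, q, a, b, hjq, hba, hab⟩ := exists_splitting_of_map_idempotent F
    (L := L) (N := W) (Y := Y) (B := ModuleCat.of Rᵐᵒᵖ (W × Y)) (ε := ε)
    (ι := ModuleCat.ofHom (Finsupp.lsingle 0)) (π := ModuleCat.ofHom (Finsupp.lapply 0))
    (up := ModuleCat.ofHom (shiftUp Rᵐᵒᵖ L)) (down := ModuleCat.ofHom (shiftDown Rᵐᵒᵖ L))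
    (e := ModuleCat.ofHom (Finsupp.mapRange.linearMap ε.hom))
    (g := ModuleCat.ofHom (c.symm.toLinearMap ∘ₗ Finsupp.mapRange.linearMap g))
    (h := ModuleCat.ofHom (Finsupp.mapRange.linearMap h ∘ₗ c.toLinearMap))
    (inl := ModuleCat.ofHom (LinearMap.inl Rᵐᵒᵖ W Y))
    (inr := ModuleCat.ofHom (LinearMap.inr Rᵐᵒᵖ W Y))
    (fst := ModuleCat.ofHom (LinearMap.fst Rᵐᵒᵖ W Y))
    (snd := ModuleCat.ofHom (LinearMap.snd Rᵐᵒᵖ W Y))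
    (ModuleCat.hom_ext (LinearMap.ext fun x => Finsupp.single_eq_same))
    (ModuleCat.hom_ext shiftDown_comp_shiftUp) (ModuleCat.hom_ext shiftUp_comp_shiftDown)
    (ModuleCat.hom_ext (mapRange_comp_shiftUp ε.hom))
    (ModuleCat.hom_ext (mapRange_comp_shiftDown ε.hom))
    rfl
    (by
      refine ModuleCat.hom_ext (LinearMap.ext fun x => Finsupp.ext fun k => ?_)
      refine Eq.trans ?_ (LinearMap.congr_fun hgh (x k)).symm
      change Finsupp.mapRange.linearMap h (c (c.symm (Finsupp.mapRange.linearMap g x))) k = _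
      rw [LinearEquiv.apply_symm_apply]
      rfl)
    (ModuleCat.hom_ext (LinearMap.fst_comp_inl _ _ _))
    (ModuleCat.hom_ext (LinearMap.snd_comp_inl _ _ _))
    (ModuleCat.hom_ext (LinearMap.fst_comp_inr _ _ _))
    (ModuleCat.hom_ext (LinearMap.snd_comp_inr _ _ _))
    (ModuleCat.hom_ext (LinearMap.ext fun x => Prod.ext (add_zero x.1) (zero_add x.2)))
    -- `Y` is a copower of `X`, so its identity lies in `𝓙_X` and `F` kills `Y`.
    (homTensor_map_eq_zero_of_mem hX' ⟨ℕ × K, LinearMap.id, LinearMap.id, rfl⟩) hεε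
  refine ⟨n, A, (hW.prod (hX.copower (ℕ × K))).of_retract j.hom q.hom
    (congrArg ModuleCat.Hom.hom hjq), ⟨⟨F.map a ≫ r, i ≫ F.map b, ?_, ?_⟩⟩⟩
  · rw [Category.assoc, ← Category.assoc r, ← hε, ← Category.assoc, ← hba]
    simp only [Category.assoc, hab, Category.comp_id]
    rfl
  · rw [Category.assoc, ← Category.assoc (F.map b), hba, hε]
    simp only [Category.assoc, hir, reassoc_of% hir]

end EssSurj

/-! ### Assembling the equivalences -/

section Induces

variable {T : Type u} [Ring T] {D : Type*} [Category* D]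

theorem inducesEquivalence_of (F : ModuleCat.{v} T ⥤ D) (P : ObjectProperty (ModuleCat.{v} T))
    (X : ModuleCat.{v} T) (Q : ObjectProperty D) (hobj : ∀ A, P A → Q (F.obj A))
    (hmap : ∀ {A B : ModuleCat.{v} T}, P A → P B → ∀ f g : A ⟶ B,
      F.map f = F.map g ↔ f - g ∈ infiniteIdeal X A B)
    (hfull : ∀ {A B : ModuleCat.{v} T}, P A → P B → ∀ φ : F.obj A ⟶ F.obj B,
      ∃ f : A ⟶ B, F.map f = φ)
    (hsurj : ∀ N, Q N → ∃ A, P A ∧ Nonempty (F.obj A ≅ N)) :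
    InducesEquivalence F P X Q := by
  refine ⟨fun A => hobj A.obj A.property, fun A B f g h => ObjectProperty.hom_ext _
    ((hmap A.property B.property f.hom g.hom).2 h), ?_⟩
  refine { faithful := ⟨?_⟩, full := ⟨?_⟩, essSurj := ⟨?_⟩ }
  · rintro ⟨A⟩ ⟨B⟩ ⟨f⟩ ⟨g⟩ h
    exact CategoryTheory.Quotient.sound _ ((hmap A.property B.property f.hom g.hom).1
      (congrArg (fun k => k.hom) h))
  · rintro ⟨A⟩ ⟨B⟩ φ
    obtain ⟨f, hf⟩ := hfull A.property B.property φ.hom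
    exact ⟨(CategoryTheory.Quotient.functor _).map (ObjectProperty.homMk f),
      ObjectProperty.hom_ext _ hf⟩
  · intro N
    obtain ⟨A, hA, ⟨e⟩⟩ := hsurj N.obj N.property
    exact ⟨⟨⟨A, hA⟩⟩, ⟨Q.isoMk e⟩⟩

end Induces

end TraceQuotient

theorem mainTheorem4 {R : Type u} [Ring R] (M : ModuleCat.{v} Rᵐᵒᵖ) [Module.Finite Rᵐᵒᵖ M]
    (X : ModuleCat.{v} Rᵐᵒᵖ) (hX : addClosure M X) :
    ((∀ s : M ⟶ M, s ∈ homTrace M X ↔ s ∈ finiteIdeal X M M) ∧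
      finiteIdeal X M M = infiniteIdeal X M M ∧
      ∀ B : ModuleCat.{v} Rᵐᵒᵖ, addClosure M B →
        finiteIdeal X M B = infiniteIdeal X M B ∧
        infiniteIdeal X M B = homMulIdeal M B (homTrace M X)) ∧
    InducesEquivalence (homTensor M (homTrace M X)) (addClosure M) X
      (addClosure (ModuleCat.of (End M ⧸ homTrace M X)ᵐᵒᵖ (End M ⧸ homTrace M X))) ∧
    (IsCountablyGenerated X →
      InducesEquivalence (homTensor M (homTrace M X)) (countableAddClosure M) X
        (countableProjective (End M ⧸ homTrace M X)ᵐᵒᵖ)) := by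
  have map_eq_iff {A B : ModuleCat.{v} Rᵐᵒᵖ} (hA : addClosure M A) (f g : A ⟶ B) :
      (homTensor M (homTrace M X)).map f = (homTensor M (homTrace M X)).map g ↔
        f - g ∈ infiniteIdeal X A B := by
    rw [← homTensor_map_eq_zero_iff hX hA, Functor.map_sub, sub_eq_zero]
  refine ⟨⟨mem_homTrace_iff hX, finiteIdeal_eq_infiniteIdeal, fun B _ =>
    ⟨finiteIdeal_eq_infiniteIdeal, infiniteIdeal_eq_homMulIdeal hX⟩⟩, ?_, fun hc => ?_⟩
  · refine inducesEquivalence_of _ _ _ _ (fun A hA => ?_) (fun hA _ => map_eq_iff hA)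
      (fun hA _ => homTensor_full _ hA) fun N hN => ?_
    · obtain ⟨Λ, h⟩ := addClosure_iff_exists_isRetractOfCopower.1 hA
      exact addClosure_iff_exists_isRetractOfCopower.2 ⟨Λ, h.homTensor hX⟩
    · obtain ⟨Λ, h⟩ := addClosure_iff_exists_isRetractOfCopower.1 hN
      obtain ⟨Λ', h'⟩ := addClosure_iff_exists_isRetractOfCopower.1 hX
      obtain ⟨n, A, hA, e⟩ := exists_iso_of_isRetractOfCopower h' h
      exact ⟨A, addClosure_iff_exists_isRetractOfCopower.2 ⟨_, hA⟩, e⟩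
  · rw [countableProjective_eq]
    have hM := isCountablyGenerated_of_finite M
    have hS := isCountablyGenerated_of_finite
      (ModuleCat.of (End M ⧸ homTrace M X)ᵐᵒᵖ (End M ⧸ homTrace M X))
    refine inducesEquivalence_of _ _ _ _ (fun A hA => ?_) (fun hA _ => map_eq_iff hA.1)
      (fun hA _ => homTensor_full _ hA.1) fun N hN => ?_
    · obtain ⟨Λ, hΛ, h⟩ := (countableAddClosure_iff_exists_isRetractOfCopower hM).1 hA
      exact (countableAddClosure_iff_exists_isRetractOfCopower hS).2 ⟨Λ, hΛ, h.homTensor hX⟩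
    · obtain ⟨Λ, hΛ, h⟩ := (countableAddClosure_iff_exists_isRetractOfCopower hS).1 hN
      obtain ⟨Λ', hΛ', h'⟩ := (countableAddClosure_iff_exists_isRetractOfCopower hM).1 ⟨hX, hc⟩
      obtain ⟨n, A, hA, e⟩ := exists_iso_of_isRetractOfCopower h' h
      -- The index set is built from `ℕ`, `Λ`, `Λ'` and finite sets by products and sums over
      -- countable sets, hence is countable.
      exact ⟨A, (countableAddClosure_iff_exists_isRetractOfCopower hM).2
        ⟨_, inferInstance, hA⟩, e⟩
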